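/- **Theorem (The primitive operad).** Let $\mathbb K$ be a field of characteristic zero. Operads are symmetric operads in $\mathbb K$-vector spaces, assumed simply connected with finite-dimensional components: $\mathcal P(0)=0$, $\mathcal P(1)=\mathbb K\,\mathrm{id}$ (one-dimensional), and $\dim\mathcal P(n)<\infty$ for all $n$. A *type of generalized bialgebras* $(\mathcal C^c,\between,\mathcal A)$ consists of two such operads $\mathcal C$ and $\mathcal A$ and a set $\between$ of compatibility relations, each of them an equality between two formal composites (under composition, tensor product, permutation of factors and linear combination) of operations of $\mathcal A$ and cooperations of $\mathcal C$. A *$\mathcal C^c$-$\mathcal A$-bialgebra* is a vector space $\mathcal H$ that is an $\mathcal A$-algebra and a $\mathcal C$-coalgebra (each $\delta\in\mathcal C(n)$ acts as a linear map $\delta:\mathcal H\to\mathcal H^{\otimes n}$, equivariantly and compatibly with the operad structure) and in which all relations of $\between$ hold. Its primitive part is $$\mathrm{Prim}\,\mathcal H:=\{x\in\mathcal H\mid \delta(x)=0\ \text{for all}\ \delta\in\mathcal C(n),\ n\ge 2\}.$$ Suppose that: * **(H0)** any pair $(\delta,\mu)$ with $\mu\in\mathcal A(n)$, $\delta\in\mathcal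 C(m)$ satisfies a distributive compatibility relation: there is a finite expression $$\delta\circ\mu=\sum_i(\mu^i_1\otimes\cdots\otimes\mu^i_m)\circ\omega^i\circ(\delta^i_1\otimes\cdots\otimes\delta^i_n),$$ valid in all $\mathcal C^c$-$\mathcal A$-bialgebras, where $\mu^i_j\in\mathcal A(k^i_j)$, $\delta^i_j\in\mathcal C(l^i_j)$, $k^i_1+\cdots+k^i_m=l^i_1+\cdots+l^i_n=r_i$ and $\omega^i\in\mathbb K[S_{r_i}]$; * **(H1)** for every vector space $V$, the free $\mathcal A$-algebra $\mathcal A(V)=\bigoplus_n\mathcal A(n)\otimes_{S_n}V^{\otimes n}$ is equipped with a $\mathcal C^c$-$\mathcal A$-bialgebra structure, extending its $\mathcal A$-algebra structure and functorial in $V$. Call $\mu\in\mathcal A(n)$ a *primitive operation* if the element $\mu(x_1,\dots,x_n)$ of $\mathcal A(\mathbb Kx_1\oplus\cdots\oplus\mathbb Kx_n)$ is primitive, and let $(\mathrm{Prim}_{\mathcal C}\mathcal A)(n)\subseteq\mathcal A(n)$ be the subspace of primitive operations. Then $\mathcal P:=\mathrm{Prim}_{\mathcal C}\mathcal A$ is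 a suboperad of $\mathcal A$: it is stable under the actions of the symmetric groups, contains $\mathrm{id}$ and is closed under composition. Moreover, for any $\mathcal C^c$-$\mathcal A$-bialgebra $\mathcal H$, the space $\mathrm{Prim}\,\mathcal H$ is a $\mathcal P$-algebra in such a way that the inclusion $\mathrm{Prim}\,\mathcal H\rightarrowtail\mathcal H$ is a morphism of $\mathcal P$-algebras, where $\mathcal H$ is a $\mathcal P$-algebra by restriction along $\mathcal P\subseteq\mathcal A$. -/

import Mathlib

universe u

namespace GenBialg

open scoped TensorProduct DirectSum

section Multilinear

variable {K : Type*} [Field K]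

/-- Extension of a map given on generators to a multilinear map, provided that it is
compatible with the linear relations between the generators in each variable separately. -/
theorem exists_multilinear_of_generators {ι : Type*} [Fintype ι] [DecidableEq ι]
    {X : ι → Type*} [∀ j, AddCommGroup (X j)] [∀ j, Module K (X j)]
    {N : Type*} [AddCommGroup N] [Module K N] {S : ι → Type*} (g : ∀ j, S j → X j)
    (hg : ∀ j, Submodule.span K (Set.range (g j)) = ⊤) (G : (∀ j, S j) → N)
    (hG : ∀ (j : ι) (s : ∀ j, S j), ∃ ψ : X j →ₗ[K] N,
      ∀ t : S j, ψ (g j t) = G (Function.update s j t)) :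
    ∃ F : MultilinearMap K X N, ∀ s : ∀ j, S j, F (fun j => g j (s j)) = G s := by
  classical
  let p : ∀ j, (S j →₀ K) →ₗ[K] X j := fun j => Finsupp.linearCombination K (g j)
  have hp : ∀ j, LinearMap.range (p j) = ⊤ := fun j => by
    rw [Finsupp.range_linearCombination, hg]
  choose σ hσ using fun j => (p j).exists_rightInverse_of_surjective (hp j)
  have hσ' : ∀ j x, p j (σ j x) = x := fun j x => LinearMap.congr_fun (hσ j) x
  let F0 : MultilinearMap K (fun j => S j →₀ K) N :=
    ((Finsupp.linearCombination K G) ∘ₗ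
      (PiTensorProduct.ofFinsuppEquiv' (R := K) (κ := S)).toLinearMap).compMultilinearMap
        (PiTensorProduct.tprod K)
  have hF0 : ∀ s : ∀ j, S j, F0 (fun j => Finsupp.single (s j) 1) = G s := fun s => by
    simp [F0]
  have hspan : ∀ j, Submodule.span K (Set.range (fun t : S j => Finsupp.single t (1 : K))) = ⊤ :=
    fun j => by
      have := (Finsupp.basisSingleOne (R := K) (ι := S j)).span_eq
      simpa using this
  have key : ∀ (j : ι) (x : ∀ j, S j →₀ K),
      F0 x = F0 (Function.update x j (σ j (p j (x j)))) := by
    intro j x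
    have h1 : F0 = F0.compLinearMap (Function.update (fun _ => LinearMap.id) j (σ j ∘ₗ p j)) := by
      refine MultilinearMap.ext_of_span_eq_top (g := fun {j} (t : S j) => Finsupp.single t (1 : K))
        hspan fun s => ?_
      obtain ⟨ψ, hψ⟩ := hG j s
      have h2 : F0.toLinearMap (fun j => Finsupp.single (s j) 1) j = ψ ∘ₗ p j := by
        refine Finsupp.lhom_ext' fun t => LinearMap.ext_ring ?_
        have : Function.update (fun j => Finsupp.single (s j) (1 : K)) j (Finsupp.single t 1)
            = fun i => Finsupp.single (Function.update s j t i) 1 := by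
          funext i
          rcases eq_or_ne i j with rfl | h
          · simp
          · simp [h]
        simp [p, hψ, this, hF0]
      have h3 : ∀ y, F0 (Function.update (fun j => Finsupp.single (s j) 1) j y) = ψ (p j y) :=
        fun y => LinearMap.congr_fun h2 y
      have h4 : (fun i => (Function.update (fun _ => LinearMap.id) j (σ j ∘ₗ p j) :
          ∀ i, (S i →₀ K) →ₗ[K] (S i →₀ K)) i (Finsupp.single (s i) 1))
          = Function.update (fun j => Finsupp.single (s j) 1) j
            (σ j (p j (Finsupp.single (s j) 1))) := by
        funext i
        rcases eq_or_ne i j with rfl | h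
        · simp
        · simp [h]
      rw [MultilinearMap.compLinearMap_apply, h4, h3, hσ', ← h3, Function.update_eq_self]
    conv_lhs => rw [h1]
    rw [MultilinearMap.compLinearMap_apply]
    congr 1
    funext i
    rcases eq_or_ne i j with rfl | h
    · simp
    · simp [h]
  have key2 : ∀ (x : ∀ j, S j →₀ K) (T : Finset ι),
      F0 x = F0 (T.piecewise (fun j => σ j (p j (x j))) x) := by
    intro x T
    induction T using Finset.induction_on with
    | empty => simp
    | insert a T ha ih =>
      rw [ih, key a, Finset.piecewise_insert]
      simp [ha]
  refine ⟨F0.compLinearMap σ, fun s => ?_⟩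
  rw [MultilinearMap.compLinearMap_apply, ← hF0, key2 (fun j => Finsupp.single (s j) 1) Finset.univ]
  simp [p]


end Multilinear

/-! ### Blocks of variables -/

/-- The bijection between pairs `(j, l)` and `{0, …, i₁ + ⋯ + i_k - 1}`, in lexicographic order:
concatenation of `k` blocks of lengths `i₁, …, i_k`. -/
abbrev flat {k : ℕ} (i : Fin k → ℕ) : (Σ j : Fin k, Fin (i j)) ≃ Fin (∑ j, i j) :=
  finSigmaFinEquiv

/-- The concatenation of `k` blocks `x_j = (x_j1, …)`. -/
def unflat {k : ℕ} {i : Fin k → ℕ} {M : Type*} (x : ∀ j, Fin (i j) → M) (p : Fin (∑ j, i j)) : M :=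
  x ((flat i).symm p).1 ((flat i).symm p).2

@[simp]
theorem unflat_flat {k : ℕ} {i : Fin k → ℕ} {M : Type*} (x : ∀ j, Fin (i j) → M) (j : Fin k)
    (l : Fin (i j)) : unflat x (flat i ⟨j, l⟩) = x j l := by
  change (fun q : (Σ j : Fin k, Fin (i j)) => x q.1 q.2) ((flat i).symm (flat i ⟨j, l⟩)) = _
  rw [Equiv.symm_apply_apply]

theorem unflat_update {k : ℕ} {i : Fin k → ℕ} {M : Type*} (s : ∀ j, Fin (i j) → M) (j : Fin k)
    [DecidableEq (Fin k)] [DecidableEq (Fin (i j))] [DecidableEq (Fin (∑ j, i j))]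
    (v : Fin (i j) → M) (l : Fin (i j)) (c : M) :
    unflat (Function.update s j (Function.update v l c)) =
      Function.update (unflat (Function.update s j v)) (flat i ⟨j, l⟩) c := by
  funext p
  obtain ⟨⟨j', l'⟩, rfl⟩ := (flat i).surjective p
  rw [unflat_flat]
  rcases eq_or_ne j' j with rfl | h
  · rcases eq_or_ne l' l with rfl | h
    · simp
    · rw [Function.update_of_ne (a := flat i ⟨j', l'⟩) (by simpa using h), unflat_flat]
      simp [h]
  · rw [Function.update_of_ne (a := flat i ⟨j', l'⟩) (by simp [h]), unflat_flat]
    simp [h]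

/-- Permutation of the blocks by `σ`, each block being kept in order. -/
def blockPerm {k k' : ℕ} (σ : Fin k ≃ Fin k') (i : Fin k' → ℕ) :
    Fin (∑ j, i (σ j)) ≃ Fin (∑ j, i j) :=
  (flat fun j => i (σ j)).symm.trans
    ((Equiv.sigmaCongrLeft (β := fun j => Fin (i j)) σ).trans (flat i))

/-- Permutation inside each block. -/
def blockSum {k : ℕ} {i i' : Fin k → ℕ} (τ : ∀ j, Fin (i j) ≃ Fin (i' j)) :
    Fin (∑ j, i j) ≃ Fin (∑ j, i' j) :=
  (flat i).symm.trans ((Equiv.sigmaCongrRight τ).trans (flat i'))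

/-- The lengths of the inner blocks, listed in one row. -/
abbrev flatArity {k : ℕ} {i : Fin k → ℕ} (a : ∀ j, Fin (i j) → ℕ) : Fin (∑ j, i j) → ℕ :=
  fun p => a ((flat i).symm p).1 ((flat i).symm p).2

/-- The two ways of concatenating blocks of blocks are identified. -/
def blockAssoc {k : ℕ} {i : Fin k → ℕ} (a : ∀ j, Fin (i j) → ℕ) :
    Fin (∑ p, flatArity a p) ≃ Fin (∑ j, ∑ l, a j l) :=
  (flat (flatArity a)).symm.trans
    ((Equiv.sigmaCongrLeft (β := fun q : (Σ j : Fin k, Fin (i j)) => Fin (a q.1 q.2))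
      (flat i).symm).trans
    ((Equiv.sigmaAssoc fun j l => Fin (a j l)).trans
    ((Equiv.sigmaCongrRight fun j => flat (a j)).trans (flat fun j => ∑ l, a j l))))

/-- One block of length `n`, identified with a row of length `n`. -/
def blockOne (n : ℕ) : Fin (∑ _j : Fin 1, n) ≃ Fin n :=
  (flat fun _ : Fin 1 => n).symm.trans (Equiv.uniqueSigma fun _ : Fin 1 => Fin n)

/-- A row of `n` blocks of length one, identified with a row of length `n`. -/
def blockOnes (n : ℕ) : Fin (∑ _j : Fin n, 1) ≃ Fin n :=
  (flat fun _ : Fin n => 1).symm.trans (Equiv.sigmaUnique (Fin n) fun _ => Fin 1)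

theorem blockPerm_flat {k k' : ℕ} (σ : Fin k ≃ Fin k') (i : Fin k' → ℕ) (j : Fin k)
    (l : Fin (i (σ j))) : blockPerm σ i (flat _ ⟨j, l⟩) = flat i ⟨σ j, l⟩ := by
  simp [blockPerm, Equiv.sigmaCongrLeft]

theorem blockSum_flat {k : ℕ} {i i' : Fin k → ℕ} (τ : ∀ j, Fin (i j) ≃ Fin (i' j)) (j : Fin k)
    (l : Fin (i j)) : blockSum τ (flat _ ⟨j, l⟩) = flat i' ⟨j, τ j l⟩ := by
  simp [blockSum]

theorem blockAssoc_flat {k : ℕ} {i : Fin k → ℕ} (a : ∀ j, Fin (i j) → ℕ) (p : Fin (∑ j, i j))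
    (t : Fin (flatArity a p)) :
    blockAssoc a (flat (flatArity a) ⟨p, t⟩) =
      flat (fun j => ∑ l, a j l) ⟨((flat i).symm p).1, flat _ ⟨((flat i).symm p).2, t⟩⟩ := by
  simp [blockAssoc, Equiv.sigmaAssoc, Equiv.sigmaCongrLeft]

theorem blockOne_flat (n : ℕ) (j : Fin 1) (l : Fin n) :
    blockOne n (flat (fun _ => n) ⟨j, l⟩) = l := by
  obtain rfl : j = default := Subsingleton.elim _ _
  simp [blockOne, Equiv.uniqueSigma]

theorem blockOnes_flat (n : ℕ) (j : Fin n) (l : Fin 1) :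
    blockOnes n (flat (fun _ => 1) ⟨j, l⟩) = j := by
  simp [blockOnes]

section Blocks

variable {K : Type*} [Field K] {M P : Type*} [AddCommGroup M] [Module K M]
  [AddCommGroup P] [Module K P]

/-- The multilinear map `f (g₁ (x₁₁, …), …, g_k (x_k1, …))`. -/
def compBlocks {k : ℕ} {i : Fin k → ℕ} {N : Fin k → Type*} [∀ j, AddCommGroup (N j)]
    [∀ j, Module K (N j)] (f : MultilinearMap K N P)
    (g : ∀ j, MultilinearMap K (fun _ : Fin (i j) => M) (N j)) :
    MultilinearMap K (fun _ : Fin (∑ j, i j) => M) P :=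
  have aux : ∀ [DecidableEq (Fin (∑ j, i j))] (x : Fin (∑ j, i j) → M) (j : Fin k)
      (l : Fin (i j)) (c : M),
      (fun j' => g j' fun l' => Function.update x (flat i ⟨j, l⟩) c (flat i ⟨j', l'⟩)) =
        Function.update (fun j' => g j' fun l' => x (flat i ⟨j', l'⟩)) j
          (g j (Function.update (fun l' => x (flat i ⟨j, l'⟩)) l c)) := by
    intro _ x j l c
    funext j'
    rcases eq_or_ne j' j with rfl | h
    · simp only [Function.update_self]
      congr 1
      funext l'
      rcases eq_or_ne l' l with rfl | h
      · simp
      · rw [Function.update_of_ne h, Function.update_of_ne]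
        simpa using h
    · rw [Function.update_of_ne h]
      congr 1
      funext l'
      rw [Function.update_of_ne]
      simp [h]
  { toFun := fun x => f fun j => g j fun l => x (flat i ⟨j, l⟩)
    map_update_add' := by
      intro _ x p c d
      obtain ⟨⟨j, l⟩, rfl⟩ := (flat i).surjective p
      simp only [aux, MultilinearMap.map_update_add]
    map_update_smul' := by
      intro _ x p c d
      obtain ⟨⟨j, l⟩, rfl⟩ := (flat i).surjective p
      simp only [aux, MultilinearMap.map_update_smul] }

@[simp]
theorem compBlocks_apply {k : ℕ} {i : Fin k → ℕ} {N : Fin k → Type*} [∀ j, AddCommGroup (N j)]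
    [∀ j, Module K (N j)] (f : MultilinearMap K N P)
    (g : ∀ j, MultilinearMap K (fun _ : Fin (i j) => M) (N j)) (x : Fin (∑ j, i j) → M) :
    compBlocks f g x = f fun j => g j fun l => x (flat i ⟨j, l⟩) := rfl

theorem span_range_tprod {ι : Type*} (X : ι → Type*) [∀ j, AddCommGroup (X j)]
    [∀ j, Module K (X j)] :
    Submodule.span K (Set.range fun x : ∀ j, X j => PiTensorProduct.tprod K x) = ⊤ :=
  PiTensorProduct.span_tprod_eq_top

/-- Concatenation `(x_j1 ⊗ ⋯)_j ↦ x_11 ⊗ ⋯ ⊗ x_k1 ⊗ ⋯` exists as a linear map. -/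
theorem exists_join (K M : Type*) [Field K] [AddCommGroup M] [Module K M]
    {k : ℕ} (i : Fin k → ℕ) :
    ∃ F : MultilinearMap K (fun j => ⨂[K] _l : Fin (i j), M) (⨂[K] _p : Fin (∑ j, i j), M),
      ∀ x : ∀ j, Fin (i j) → M, F (fun j => PiTensorProduct.tprod K (x j)) =
        PiTensorProduct.tprod K (unflat x) := by
  refine exists_multilinear_of_generators
    (fun j (x : Fin (i j) → M) => PiTensorProduct.tprod K x) (fun j => span_range_tprod _)
    (fun x => PiTensorProduct.tprod K (unflat x))
    fun j s => ?_
  let m : MultilinearMap K (fun _ : Fin (i j) => M) (⨂[K] _p : Fin (∑ j, i j), M) :=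
    { toFun := fun v => PiTensorProduct.tprod K (unflat (Function.update s j v))
      map_update_add' := by
        intro _ v l c d
        simp only [unflat_update, MultilinearMap.map_update_add]
      map_update_smul' := by
        intro _ v l c d
        simp only [unflat_update, MultilinearMap.map_update_smul] }
  exact ⟨PiTensorProduct.lift m, fun t => by simp [m]⟩

/-- The identification `M^{⊗ i₁} ⊗ ⋯ ⊗ M^{⊗ i_k} → M^{⊗ (i₁ + ⋯ + i_k)}`. -/
noncomputable def join (K M : Type*) [Field K] [AddCommGroup M] [Module K M]
    {k : ℕ} (i : Fin k → ℕ) :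
    (⨂[K] j, ⨂[K] _l : Fin (i j), M) →ₗ[K] ⨂[K] _p : Fin (∑ j, i j), M :=
  PiTensorProduct.lift (exists_join K M i).choose

theorem join_tprod {k : ℕ} (i : Fin k → ℕ) (x : ∀ j, Fin (i j) → M) :
    join K M i (PiTensorProduct.tprod K fun j => PiTensorProduct.tprod K (x j)) =
      PiTensorProduct.tprod K (unflat x) := by
  rw [join, PiTensorProduct.lift.tprod, (exists_join K M i).choose_spec]

/-- The inverse identification `M^{⊗ (i₁ + ⋯ + i_k)} → M^{⊗ i₁} ⊗ ⋯ ⊗ M^{⊗ i_k}`. -/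
noncomputable def split (K M : Type*) [Field K] [AddCommGroup M] [Module K M]
    {k : ℕ} (i : Fin k → ℕ) :
    (⨂[K] _p : Fin (∑ j, i j), M) →ₗ[K] ⨂[K] j, ⨂[K] _l : Fin (i j), M :=
  PiTensorProduct.lift
    (compBlocks (PiTensorProduct.tprod K) fun _ => PiTensorProduct.tprod K)

theorem split_tprod {k : ℕ} (i : Fin k → ℕ) (x : Fin (∑ j, i j) → M) :
    split K M i (PiTensorProduct.tprod K x) =
      PiTensorProduct.tprod K fun j => PiTensorProduct.tprod K fun l => x (flat i ⟨j, l⟩) := by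
  rw [split, PiTensorProduct.lift.tprod, compBlocks_apply]

end Blocks

/-! ### Operads, algebras and coalgebras -/

/-- A family of right `S_n`-modules, written as a contravariant functor on the groupoid of the
sets `Fin n` and their bijections. As `Fin m ≃ Fin n` forces `m = n`, the action consists
of the right actions `μ ↦ μ^σ` of the groups `S_n` alone. -/
structure SModule (K : Type u) [Field K] where
  obj : ℕ → Type u
  [addCommGroup : ∀ n, AddCommGroup (obj n)]
  [module : ∀ n, Module K (obj n)]
  act : ∀ {m n : ℕ}, (Fin m ≃ Fin n) → obj n →ₗ[K] obj m
  act_refl : ∀ {n : ℕ} (μ : obj n), act (Equiv.refl (Fin n)) μ = μ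
  act_trans : ∀ {m n p : ℕ} (e : Fin m ≃ Fin n) (f : Fin n ≃ Fin p) (μ : obj p),
    act (e.trans f) μ = act e (act f μ)

attribute [instance] SModule.addCommGroup SModule.module

/-- A (symmetric, algebraic) operad over `K`, given by the composition maps
`γ : P(k) ⊗ P(i₁) ⊗ ⋯ ⊗ P(i_k) → P(i₁ + ⋯ + i_k)` and the identity operation. -/
structure Operad (K : Type u) [Field K] extends SModule K where
  one : obj 1
  comp : ∀ {k : ℕ} {i : Fin k → ℕ},
    obj k →ₗ[K] MultilinearMap K (fun j => obj (i j)) (obj (∑ j, i j))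
  comp_act_left : ∀ {k k' : ℕ} {i : Fin k' → ℕ} (σ : Fin k ≃ Fin k') (μ : obj k')
    (ν : ∀ j, obj (i j)),
    comp (act σ μ) (fun j => ν (σ j)) = act (blockPerm σ i) (comp μ ν)
  comp_act_right : ∀ {k : ℕ} {i i' : Fin k → ℕ} (τ : ∀ j, Fin (i j) ≃ Fin (i' j)) (μ : obj k)
    (ν : ∀ j, obj (i' j)),
    comp μ (fun j => act (τ j) (ν j)) = act (blockSum τ) (comp μ ν)
  comp_assoc : ∀ {k : ℕ} {i : Fin k → ℕ} {a : ∀ j, Fin (i j) → ℕ} (μ : obj k)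
    (ν : ∀ j, obj (i j)) (ξ : ∀ j l, obj (a j l)),
    comp (i := flatArity a) (comp μ ν) (fun p => ξ ((flat i).symm p).1 ((flat i).symm p).2) =
      act (blockAssoc a) (comp μ fun j => comp (ν j) (ξ j))
  one_comp : ∀ {n : ℕ} (μ : obj n), comp (k := 1) one (fun _ => μ) = act (blockOne n) μ
  comp_one : ∀ {n : ℕ} (μ : obj n), comp μ (fun _ => one) = act (blockOnes n) μ

variable {K : Type u} [Field K]

/-- The standing conventions on operads: `P(0) = 0`, `P(1) = K id` is one-dimensional, and all
`P(n)` are finite dimensional. -/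
structure Operad.IsSimplyConnected (P : Operad K) : Prop where
  zero : ∀ μ : P.obj 0, μ = 0
  one_ne_zero : P.one ≠ 0
  exists_smul_one : ∀ μ : P.obj 1, ∃ c : K, μ = c • P.one
  finiteDimensional : ∀ n, FiniteDimensional K (P.obj n)

/-- An algebra over the operad `P`: `op μ (x₁, …, x_n)` is `μ(x₁, …, x_n)`. -/
structure OperadAlgebra (P : Operad K) (M : Type u) [AddCommGroup M] [Module K M] where
  op : ∀ {n : ℕ}, P.obj n →ₗ[K] MultilinearMap K (fun _ : Fin n => M) M
  op_act : ∀ {m n : ℕ} (e : Fin m ≃ Fin n) (μ : P.obj n) (x : Fin m → M),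
    op (P.act e μ) x = op μ (fun j => x (e.symm j))
  op_one : ∀ x : Fin 1 → M, op P.one x = x 0
  op_comp : ∀ {k : ℕ} {i : Fin k → ℕ} (μ : P.obj k) (ν : ∀ j, P.obj (i j))
    (x : Fin (∑ j, i j) → M),
    op (P.comp μ ν) x = op μ (fun j => op (ν j) (fun l => x (flat i ⟨j, l⟩)))

/-- A linear map that commutes with all operations. -/
def OperadAlgebra.IsHom {P : Operad K} {M N : Type u} [AddCommGroup M] [Module K M]
    [AddCommGroup N] [Module K N] (a : OperadAlgebra P M) (b : OperadAlgebra P N)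
    (f : M →ₗ[K] N) : Prop :=
  ∀ (n : ℕ) (μ : P.obj n) (x : Fin n → M), f (a.op μ x) = b.op μ (fun j => f (x j))

/-- A coalgebra over the operad `P`: every `δ ∈ P(n)` acts as a cooperation `M → M^{⊗ n}`. -/
structure OperadCoalgebra (P : Operad K) (M : Type u) [AddCommGroup M] [Module K M] where
  coop : ∀ {n : ℕ}, P.obj n →ₗ[K] M →ₗ[K] ⨂[K] _j : Fin n, M
  coop_act : ∀ {m n : ℕ} (e : Fin m ≃ Fin n) (δ : P.obj n) (x : M),
    coop (P.act e δ) x = PiTensorProduct.reindex K (fun _ => M) e.symm (coop δ x)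
  coop_one : ∀ x : M, coop P.one x = PiTensorProduct.tprod K fun _ => x
  coop_comp : ∀ {k : ℕ} {i : Fin k → ℕ} (δ : P.obj k) (ε : ∀ j, P.obj (i j)) (x : M),
    coop (P.comp δ ε) x =
      join K M i (PiTensorProduct.map (fun j => coop (ε j)) (coop δ x))

/-- A linear map that commutes with all cooperations. -/
def OperadCoalgebra.IsHom {P : Operad K} {M N : Type u} [AddCommGroup M] [Module K M]
    [AddCommGroup N] [Module K N] (a : OperadCoalgebra P M) (b : OperadCoalgebra P N)
    (f : M →ₗ[K] N) : Prop :=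
  ∀ (n : ℕ) (δ : P.obj n) (x : M),
    b.coop δ (f x) = PiTensorProduct.map (fun _ => f) (a.coop δ x)

/-- The primitive part: the elements annihilated by all cooperations of arity at least two. -/
def OperadCoalgebra.prim {P : Operad K} {M : Type u} [AddCommGroup M] [Module K M]
    (a : OperadCoalgebra P M) : Submodule K M where
  carrier := {x | ∀ n, 2 ≤ n → ∀ δ : P.obj n, a.coop δ x = 0}
  zero_mem' := fun n _ δ => by simp
  add_mem' := fun hx hy n hn δ => by rw [map_add, hx n hn, hy n hn, add_zero]
  smul_mem' := fun c x hx n hn δ => by rw [map_smul, hx n hn, smul_zero]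

/-! ### Suboperads -/

/-- A suboperad: a sub-`S`-module that contains the identity and is closed under composition. -/
structure Suboperad (P : Operad K) where
  carrier : ∀ n, Submodule K (P.obj n)
  act_mem : ∀ {m n : ℕ} (e : Fin m ≃ Fin n) {μ : P.obj n}, μ ∈ carrier n →
    P.act e μ ∈ carrier m
  one_mem : P.one ∈ carrier 1
  comp_mem : ∀ {k : ℕ} {i : Fin k → ℕ} {μ : P.obj k} {ν : ∀ j, P.obj (i j)}, μ ∈ carrier k →
    (∀ j, ν j ∈ carrier (i j)) → P.comp μ ν ∈ carrier (∑ j, i j)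

/-- A suboperad as an operad in its own right. -/
def Suboperad.toOperad {P : Operad K} (Q : Suboperad P) : Operad K where
  obj n := Q.carrier n
  act e := (P.act e).restrict fun _ h => Q.act_mem e h
  act_refl μ := Subtype.ext (P.act_refl _)
  act_trans e f μ := Subtype.ext (P.act_trans e f _)
  one := ⟨P.one, Q.one_mem⟩
  comp {k i} :=
    { toFun := fun μ =>
        { toFun := fun ν => ⟨P.comp μ.1 fun j => (ν j).1, Q.comp_mem μ.2 fun j => (ν j).2⟩
          map_update_add' := by
            intro _ ν j c d
            ext1
            simp only [Function.apply_update (fun j (c : Q.carrier (i j)) => (c : P.obj (i j))),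
              Submodule.coe_add, MultilinearMap.map_update_add]
          map_update_smul' := by
            intro _ ν j c d
            ext1
            simp only [Function.apply_update (fun j (c : Q.carrier (i j)) => (c : P.obj (i j))),
              Submodule.coe_smul, MultilinearMap.map_update_smul] }
      map_add' := by
        intro μ μ'
        ext ν
        simp
      map_smul' := by
        intro c μ
        ext ν
        simp }
  comp_act_left σ μ ν := Subtype.ext (P.comp_act_left σ μ.1 fun j => (ν j).1)
  comp_act_right τ μ ν := Subtype.ext (P.comp_act_right τ μ.1 fun j => (ν j).1)
  comp_assoc μ ν ξ := Subtype.ext (P.comp_assoc μ.1 (fun j => (ν j).1) fun j l => (ξ j l).1)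
  one_comp μ := Subtype.ext (P.one_comp μ.1)
  comp_one μ := Subtype.ext (P.comp_one μ.1)

/-- Restriction of an algebra structure to a suboperad. -/
def OperadAlgebra.restrict {P : Operad K} {M : Type u} [AddCommGroup M] [Module K M]
    (a : OperadAlgebra P M) (Q : Suboperad P) : OperadAlgebra Q.toOperad M where
  op {n} := a.op ∘ₗ (Q.carrier n).subtype
  op_act e μ x := a.op_act e μ.1 x
  op_one x := a.op_one x
  op_comp μ ν x := a.op_comp μ.1 (fun j => (ν j).1) x

/-! ### Schur functors and free algebras -/

/-- The relations `μ^σ ⊗ t = μ ⊗ σ·t` that define `S(n) ⊗_{S_n} V^{⊗ n}`. -/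
def SModule.balancing (S : SModule K) (V : Type u) [AddCommGroup V] [Module K V] (n : ℕ) :
    Submodule K (S.obj n ⊗[K] (⨂[K] _j : Fin n, V)) :=
  Submodule.span K {z | ∃ (σ : Equiv.Perm (Fin n)) (μ : S.obj n) (t : ⨂[K] _j : Fin n, V),
    z = S.act σ μ ⊗ₜ[K] t - μ ⊗ₜ[K] PiTensorProduct.reindex K (fun _ => V) σ t}

/-- The summand `S(n) ⊗_{S_n} V^{⊗ n}`. -/
def SModule.SchurSummand (S : SModule K) (V : Type u) [AddCommGroup V] [Module K V] (n : ℕ) :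
    Type u :=
  (S.obj n ⊗[K] (⨂[K] _j : Fin n, V)) ⧸ S.balancing V n

noncomputable instance (S : SModule K) (V : Type u) [AddCommGroup V] [Module K V] (n : ℕ) :
    AddCommGroup (S.SchurSummand V n) :=
  inferInstanceAs (AddCommGroup ((S.obj n ⊗[K] (⨂[K] _j : Fin n, V)) ⧸ S.balancing V n))

noncomputable instance (S : SModule K) (V : Type u) [AddCommGroup V] [Module K V] (n : ℕ) :
    Module K (S.SchurSummand V n) :=
  inferInstanceAs (Module K ((S.obj n ⊗[K] (⨂[K] _j : Fin n, V)) ⧸ S.balancing V n))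

/-- The Schur functor `S(V) = ⨁ₙ S(n) ⊗_{S_n} V^{⊗ n}`. -/
def SModule.Schur (S : SModule K) (V : Type u) [AddCommGroup V] [Module K V] : Type u :=
  ⨁ n : ℕ, S.SchurSummand V n

noncomputable instance (S : SModule K) (V : Type u) [AddCommGroup V] [Module K V] :
    AddCommGroup (S.Schur V) :=
  inferInstanceAs (AddCommGroup (⨁ n : ℕ, S.SchurSummand V n))

noncomputable instance (S : SModule K) (V : Type u) [AddCommGroup V] [Module K V] :
    Module K (S.Schur V) :=
  inferInstanceAs (Module K (⨁ n : ℕ, S.SchurSummand V n))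

section Schur

variable (S : SModule K) {V W : Type u} [AddCommGroup V] [Module K V] [AddCommGroup W]
  [Module K W]

/-- The projection `S(n) ⊗ V^{⊗ n} → S(n) ⊗_{S_n} V^{⊗ n}`. -/
noncomputable def SModule.proj (V : Type u) [AddCommGroup V] [Module K V] (n : ℕ) :
    (S.obj n ⊗[K] (⨂[K] _j : Fin n, V)) →ₗ[K] S.SchurSummand V n :=
  (S.balancing V n).mkQ

/-- The inclusion `S(n) ⊗_{S_n} V^{⊗ n} → S(V)`. -/
noncomputable def SModule.incl (V : Type u) [AddCommGroup V] [Module K V] (n : ℕ) :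
    S.SchurSummand V n →ₗ[K] S.Schur V :=
  DirectSum.lof K ℕ (S.SchurSummand V) n

/-- The class of `μ ⊗ (v₁ ⊗ ⋯ ⊗ v_n)` in `S(n) ⊗_{S_n} V^{⊗ n}`. -/
noncomputable def SModule.mkSummand {n : ℕ} (μ : S.obj n) (v : Fin n → V) : S.SchurSummand V n :=
  S.proj V n (μ ⊗ₜ[K] PiTensorProduct.tprod K v)

/-- The element `(μ; v₁, …, v_n)` of `S(V)`. -/
noncomputable def SModule.cls {n : ℕ} (μ : S.obj n) (v : Fin n → V) : S.Schur V :=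
  S.incl V n (S.mkSummand μ v)

/-- Functoriality of the summands of the Schur functor. -/
noncomputable def SModule.mapSummand (f : V →ₗ[K] W) (n : ℕ) :
    S.SchurSummand V n →ₗ[K] S.SchurSummand W n :=
  (S.balancing V n).mapQ (S.balancing W n)
    (TensorProduct.map LinearMap.id (PiTensorProduct.map fun _ => f)) (by
      rw [SModule.balancing, Submodule.span_le]
      rintro _ ⟨σ, μ, t, rfl⟩
      refine Submodule.subset_span ⟨σ, μ, PiTensorProduct.map (fun _ => f) t, ?_⟩
      rw [map_sub, TensorProduct.map_tmul, TensorProduct.map_tmul,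
        ← PiTensorProduct.map_reindex (fun _ => f) σ t]
      rfl)

/-- Functoriality of the Schur functor: the map `S(f) : S(V) → S(W)`. -/
noncomputable def SModule.map (f : V →ₗ[K] W) : S.Schur V →ₗ[K] S.Schur W :=
  DirectSum.lmap (S.mapSummand f)

theorem SModule.map_cls (f : V →ₗ[K] W) {n : ℕ} (μ : S.obj n) (v : Fin n → V) :
    S.map f (S.cls μ v) = S.cls μ (fun j => f (v j)) := by
  have h : S.mapSummand f n (S.mkSummand μ v) = S.mkSummand μ (fun j => f (v j)) := by
    refine (Submodule.mapQ_apply _ _ _ _).trans ?_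
    rw [TensorProduct.map_tmul, PiTensorProduct.map_tprod]
    rfl
  unfold SModule.cls
  rw [← h]
  exact DirectSum.lmap_lof _ _ _

theorem SModule.proj_act (n : ℕ) (σ : Equiv.Perm (Fin n)) (μ : S.obj n)
    (t : ⨂[K] _j : Fin n, V) :
    S.proj V n (S.act σ μ ⊗ₜ[K] t) =
      S.proj V n (μ ⊗ₜ[K] PiTensorProduct.reindex K (fun _ => V) σ t) :=
  (Submodule.Quotient.eq _).2 (Submodule.subset_span ⟨σ, μ, t, rfl⟩)

theorem SModule.cls_act {m n : ℕ} (e : Fin m ≃ Fin n) (μ : S.obj n) (v : Fin m → V) :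
    S.cls (S.act e μ) v = S.cls μ (fun j => v (e.symm j)) := by
  obtain rfl : m = n := Fin.equiv_iff_eq.mp ⟨e⟩
  unfold SModule.cls SModule.mkSummand
  rw [S.proj_act, PiTensorProduct.reindex_tprod]

/-- `(μ; v₁, …, v_n)` as a function that is linear in `μ` and multilinear in the `v_j`. -/
noncomputable def SModule.mkMultilinear (V : Type u) [AddCommGroup V] [Module K V] (n : ℕ) :
    S.obj n →ₗ[K] MultilinearMap K (fun _ : Fin n => V) (S.Schur V) where
  toFun μ :=
    ((S.incl V n ∘ₗ S.proj V n) ∘ₗ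
      TensorProduct.mk K _ _ μ).compMultilinearMap (PiTensorProduct.tprod K)
  map_add' μ μ' := by
    refine MultilinearMap.ext fun v => ?_
    simp
  map_smul' c μ := by
    refine MultilinearMap.ext fun v => ?_
    simp

@[simp]
theorem SModule.mkMultilinear_apply {n : ℕ} (μ : S.obj n) (v : Fin n → V) :
    S.mkMultilinear V n μ v = S.cls μ v := rfl

theorem SModule.span_mkSummand (n : ℕ) :
    Submodule.span K (Set.range fun s : S.obj n × (Fin n → V) => S.mkSummand s.1 s.2) = ⊤ := by
  rw [eq_top_iff]
  rintro x -
  obtain ⟨x, rfl⟩ : ∃ y, S.proj V n y = x := (S.balancing V n).mkQ_surjective x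
  induction x using TensorProduct.induction_on with
  | zero => simp
  | add x y hx hy => rw [map_add]; exact add_mem hx hy
  | tmul μ t =>
    have ht : t ∈ Submodule.span K (Set.range (PiTensorProduct.tprod K (s := fun _ : Fin n => V))) :=
      by rw [PiTensorProduct.span_tprod_eq_top]; trivial
    induction ht using Submodule.span_induction with
    | mem t h => obtain ⟨v, rfl⟩ := h; exact Submodule.subset_span ⟨(μ, v), rfl⟩
    | zero => simp
    | add x y _ _ hx hy => rw [TensorProduct.tmul_add, map_add]; exact add_mem hx hy
    | smul c x _ hx => rw [TensorProduct.tmul_smul, map_smul]; exact Submodule.smul_mem _ _ hx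

theorem SModule.span_cls :
    Submodule.span K (Set.range fun s : (Σ n, S.obj n × (Fin n → V)) => S.cls s.2.1 s.2.2) = ⊤ := by
  rw [eq_top_iff]
  rintro x -
  induction x using DirectSum.induction_on with
  | zero => exact zero_mem _
  | add x y hx hy => exact add_mem hx hy
  | of n x =>
    have hx : x ∈ Submodule.span K
        (Set.range fun s : S.obj n × (Fin n → V) => S.mkSummand s.1 s.2) := by
      rw [S.span_mkSummand]; trivial
    change S.incl V n x ∈ _
    induction hx using Submodule.span_induction with
    | mem t h => obtain ⟨s, rfl⟩ := h; exact Submodule.subset_span ⟨⟨n, s⟩, rfl⟩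
    | zero => simp
    | add x y _ _ hx hy => rw [map_add]; exact add_mem hx hy
    | smul c x _ hx => rw [map_smul]; exact Submodule.smul_mem _ _ hx

end Schur

section Free

variable (P : Operad K) (V : Type u) [AddCommGroup V] [Module K V]

variable {V} in
/-- The linear map on `P(n) ⊗_{S_n} V^{⊗ n}` defined by a linear family of multilinear maps. -/
theorem SModule.exists_linear {S : SModule K} {N : Type*} [AddCommGroup N] [Module K N] {n : ℕ}
    (m : S.obj n →ₗ[K] MultilinearMap K (fun _ : Fin n => V) N)
    (hm : ∀ (σ : Equiv.Perm (Fin n)) (a : S.obj n) (v : Fin n → V),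
      m (S.act σ a) v = m a fun l => v (σ.symm l)) :
    ∃ ψ : S.SchurSummand V n →ₗ[K] N, ∀ (a : S.obj n) (v : Fin n → V),
      ψ (S.mkSummand a v) = m a v := by
  let ψ0 : (S.obj n ⊗[K] (⨂[K] _l : Fin n, V)) →ₗ[K] N :=
    TensorProduct.lift ((PiTensorProduct.lift (R := K)).toLinearMap ∘ₗ m)
  have h0 : S.balancing V n ≤ LinearMap.ker ψ0 := by
    rw [SModule.balancing, Submodule.span_le]
    rintro _ ⟨σ, a, t, rfl⟩
    rw [SetLike.mem_coe, LinearMap.mem_ker, map_sub, sub_eq_zero]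
    have : ψ0 ∘ₗ TensorProduct.mk K _ _ (S.act σ a) =
        (ψ0 ∘ₗ TensorProduct.mk K _ _ a) ∘ₗ
          (PiTensorProduct.reindex K (fun _ => V) σ).toLinearMap := by
      refine PiTensorProduct.ext (MultilinearMap.ext fun v => ?_)
      simpa [ψ0] using hm σ a v
    exact LinearMap.congr_fun this t
  refine ⟨(S.balancing V n).liftQ ψ0 h0, fun a v => ?_⟩
  refine (Submodule.liftQ_apply _ _ _).trans ?_
  simp [ψ0]

/-- The value `(μ ∘ (ν₁, …, ν_k); v₁, …, v_k)`, as a function of `ν_j` and `v_j` for one `j`. -/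
noncomputable def Operad.freeOpAux {k : ℕ} (μ : P.obj k) (i : Fin k → ℕ) (ν : ∀ j, P.obj (i j))
    (w : ∀ j, Fin (i j) → V) (j : Fin k) :
    P.obj (i j) →ₗ[K] MultilinearMap K (fun _ : Fin (i j) => V) (P.Schur V) where
  toFun a :=
    { toFun := fun v => P.mkMultilinear V _ (P.comp μ (Function.update ν j a))
        (unflat (Function.update w j v))
      map_update_add' := by
        intro _ v l c d
        simp only [unflat_update, MultilinearMap.map_update_add]
      map_update_smul' := by
        intro _ v l c d
        simp only [unflat_update, MultilinearMap.map_update_smul] }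
  map_add' a a' := by
    refine MultilinearMap.ext fun v => ?_
    simp only [MultilinearMap.coe_mk, add_apply,
      MultilinearMap.map_update_add, map_add]
  map_smul' c a := by
    refine MultilinearMap.ext fun v => ?_
    simp only [MultilinearMap.coe_mk, smul_apply,
      MultilinearMap.map_update_smul, map_smul, RingHom.id_apply]

theorem Operad.freeOpAux_apply {k : ℕ} (μ : P.obj k) (i : Fin k → ℕ) (ν : ∀ j, P.obj (i j))
    (w : ∀ j, Fin (i j) → V) (j : Fin k) (a : P.obj (i j)) (v : Fin (i j) → V) :
    P.freeOpAux V μ i ν w j a v =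
      P.cls (P.comp μ (Function.update ν j a)) (unflat (Function.update w j v)) := rfl

theorem Operad.freeOpAux_act {k : ℕ} (μ : P.obj k) (i : Fin k → ℕ) (ν : ∀ j, P.obj (i j))
    (w : ∀ j, Fin (i j) → V) (j : Fin k) (σ : Equiv.Perm (Fin (i j))) (a : P.obj (i j))
    (v : Fin (i j) → V) :
    P.freeOpAux V μ i ν w j (P.act σ a) v =
      P.freeOpAux V μ i ν w j a fun l => v (σ.symm l) := by
  rw [Operad.freeOpAux_apply, Operad.freeOpAux_apply]
  let τ : ∀ j', Fin (i j') ≃ Fin (i j') := Function.update (fun _ => Equiv.refl _) j σ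
  have h1 : Function.update ν j (P.act σ a) =
      fun j' => P.act (τ j') (Function.update ν j a j') := by
    funext j'
    rcases eq_or_ne j' j with rfl | h
    · simp [τ]
    · simp [τ, h, P.act_refl]
  have h2 : (fun p => unflat (Function.update w j v) ((blockSum τ).symm p)) =
      unflat (Function.update w j fun l => v (σ.symm l)) := by
    funext p
    obtain ⟨p, rfl⟩ := (blockSum τ).surjective p
    obtain ⟨⟨j', l⟩, rfl⟩ := (flat i).surjective p
    rw [Equiv.symm_apply_apply, blockSum_flat, unflat_flat, unflat_flat]
    rcases eq_or_ne j' j with rfl | h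
    · simp [τ]
    · simp [τ, h]
  rw [h1, P.comp_act_right, P.cls_act, h2]

/-- On generators, `(μ; (ν₁; v₁), …, (ν_k; v_k)) ↦ (μ ∘ (ν₁, …, ν_k); v₁, …, v_k)` is compatible
with the linear relations, hence extends to a multilinear map. -/
theorem Operad.exists_freeOp {k : ℕ} (μ : P.obj k) (i : Fin k → ℕ) :
    ∃ F : MultilinearMap K (fun j => P.SchurSummand V (i j)) (P.Schur V),
      ∀ s : ∀ j, P.obj (i j) × (Fin (i j) → V),
        F (fun j => P.mkSummand (s j).1 (s j).2) =
          P.cls (P.comp μ fun j => (s j).1) (unflat fun j => (s j).2) := by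
  refine exists_multilinear_of_generators
    (fun j (s : P.obj (i j) × (Fin (i j) → V)) => P.mkSummand s.1 s.2)
    (fun j => P.span_mkSummand (i j))
    (fun s => P.cls (P.comp μ fun j => (s j).1) (unflat fun j => (s j).2)) fun j s => ?_
  obtain ⟨ψ, hψ⟩ := SModule.exists_linear
    (P.freeOpAux V μ i (fun j' => (s j').1) (fun j' => (s j').2) j)
    (P.freeOpAux_act V μ i (fun j' => (s j').1) (fun j' => (s j').2) j)
  refine ⟨ψ, fun t => ?_⟩
  rw [hψ, Operad.freeOpAux_apply]
  have h1 : (fun j' => (Function.update s j t j').1) =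
      Function.update (fun j' => (s j').1) j t.1 :=
    funext fun j' => Function.apply_update (fun _ => Prod.fst) s j t j'
  have h2 : (fun j' => (Function.update s j t j').2) =
      Function.update (fun j' => (s j').2) j t.2 :=
    funext fun j' => Function.apply_update (fun _ => Prod.snd) s j t j'
  rw [h1, h2]

/-- The operation `μ` on `P(V)`, as a multilinear map. -/
noncomputable def Operad.freeOp {k : ℕ} (μ : P.obj k) :
    MultilinearMap K (fun _ : Fin k => P.Schur V) (P.Schur V) :=
  MultilinearMap.fromDirectSumEquiv fun i => (P.exists_freeOp V μ i).choose

theorem Operad.freeOp_cls {k : ℕ} (μ : P.obj k) {i : Fin k → ℕ} (ν : ∀ j, P.obj (i j))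
    (v : ∀ j, Fin (i j) → V) :
    P.freeOp V μ (fun j => P.cls (ν j) (v j)) = P.cls (P.comp μ ν) (unflat v) := by
  have h := (P.exists_freeOp V μ i).choose_spec fun j => (ν j, v j)
  rw [← h]
  exact MultilinearMap.fromDirectSumEquiv_lof
    (fun i => (P.exists_freeOp V μ i).choose) i fun j => P.mkSummand (ν j) (v j)

/-- Multilinear maps on `P(V)` are determined by their values on the elements `(ν; v₁, …, v_n)`. -/
theorem Operad.multilinear_ext {ι : Type*} [Finite ι] {N : Type*}
    [AddCommGroup N] [Module K N] {F F' : MultilinearMap K (fun _ : ι => P.Schur V) N}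
    (h : ∀ (i : ι → ℕ) (ν : ∀ j, P.obj (i j)) (v : ∀ j, Fin (i j) → V),
      F (fun j => P.cls (ν j) (v j)) = F' (fun j => P.cls (ν j) (v j))) : F = F' :=
  MultilinearMap.ext_of_span_eq_top
    (g := fun {_} (s : Σ n, P.obj n × (Fin n → V)) => P.cls s.2.1 s.2.2)
    (fun _ => P.span_cls) fun s => h (fun j => (s j).1) (fun j => (s j).2.1) fun j => (s j).2.2

theorem Operad.freeOp_add {n : ℕ} (μ μ' : P.obj n) :
    P.freeOp V (μ + μ') = P.freeOp V μ + P.freeOp V μ' :=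
  P.multilinear_ext V fun i ν v => by
    rw [add_apply, P.freeOp_cls, P.freeOp_cls, P.freeOp_cls, map_add, add_apply]
    simp only [← SModule.mkMultilinear_apply, map_add, add_apply]

theorem Operad.freeOp_smul {n : ℕ} (c : K) (μ : P.obj n) :
    P.freeOp V (c • μ) = c • P.freeOp V μ :=
  P.multilinear_ext V fun i ν v => by
    rw [smul_apply, P.freeOp_cls, P.freeOp_cls, map_smul, smul_apply]
    simp only [← SModule.mkMultilinear_apply, map_smul, smul_apply]

theorem Operad.freeOp_act {m n : ℕ} (e : Fin m ≃ Fin n) (μ : P.obj n) :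
    P.freeOp V (P.act e μ) = (P.freeOp V μ).domDomCongr e.symm :=
  P.multilinear_ext V fun i ν v => by
    obtain rfl : m = n := Fin.equiv_iff_eq.mp ⟨e⟩
    obtain ⟨i, rfl⟩ : ∃ i', i = fun j => i' (e j) := ⟨fun j => i (e.symm j), by simp⟩
    obtain ⟨ν, rfl⟩ : ∃ ν' : ∀ j, P.obj (i j), ν = fun j => ν' (e j) :=
      ⟨(Equiv.piCongrLeft (fun j => P.obj (i j)) e) ν, by
        funext j; exact (Equiv.piCongrLeft_apply_apply (fun j => P.obj (i j)) e ν j).symm⟩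
    obtain ⟨v, rfl⟩ : ∃ v' : ∀ j, Fin (i j) → V, v = fun j => v' (e j) :=
      ⟨(Equiv.piCongrLeft (fun j => Fin (i j) → V) e) v, by
        funext j; exact (Equiv.piCongrLeft_apply_apply (fun j => Fin (i j) → V) e v j).symm⟩
    rw [P.freeOp_cls, P.comp_act_left, P.cls_act, MultilinearMap.domDomCongr_apply]
    have h := P.freeOp_cls V μ ν v
    have h1 : (fun j => P.cls (ν (e (e.symm j))) (v (e (e.symm j)))) =
        fun j => P.cls (ν j) (v j) := by
      funext j
      rw [Equiv.apply_symm_apply]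
    rw [h1, h]
    congr 1
    funext p
    obtain ⟨p, rfl⟩ := (blockPerm e i).surjective p
    obtain ⟨⟨j, l⟩, rfl⟩ := (flat _).surjective p
    rw [Equiv.symm_apply_apply, blockPerm_flat, unflat_flat, unflat_flat]

theorem Operad.freeOp_one (x : Fin 1 → P.Schur V) : P.freeOp V P.one x = x 0 := by
  have : P.freeOp V P.one = MultilinearMap.ofSubsingleton K (P.Schur V) (P.Schur V) (0 : Fin 1)
      LinearMap.id :=
    P.multilinear_ext V fun i ν v => by
      obtain ⟨n, rfl⟩ : ∃ n, i = fun _ => n := ⟨i 0, by funext j; rw [Subsingleton.elim j 0]⟩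
      obtain ⟨a, rfl⟩ : ∃ a, ν = fun _ => a := ⟨ν 0, by funext j; rw [Subsingleton.elim j 0]⟩
      obtain ⟨w, rfl⟩ : ∃ w, v = fun _ => w := ⟨v 0, by funext j; rw [Subsingleton.elim j 0]⟩
      rw [P.freeOp_cls, P.one_comp, P.cls_act]
      have : (fun j => unflat (fun _ : Fin 1 => w) ((blockOne n).symm j)) = w := by
        funext p
        obtain ⟨p, rfl⟩ := (blockOne n).surjective p
        obtain ⟨⟨j, l⟩, rfl⟩ := (flat _).surjective p
        rw [Equiv.symm_apply_apply, blockOne_flat, unflat_flat]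
      rw [this]
      simp
  rw [this]
  simp

theorem Operad.freeOp_comp {k : ℕ} {i : Fin k → ℕ} (μ : P.obj k) (ν : ∀ j, P.obj (i j)) :
    P.freeOp V (P.comp μ ν) = compBlocks (P.freeOp V μ) fun j => P.freeOp V (ν j) :=
  P.multilinear_ext V fun a ξ v => by
    obtain ⟨a, rfl⟩ : ∃ a' : ∀ j, Fin (i j) → ℕ, a = flatArity a' :=
      ⟨fun j l => a (flat i ⟨j, l⟩), by funext p; exact (congrArg a ((flat i).apply_symm_apply p)).symm⟩
    let β : (Σ j, Fin (i j)) → Type u := fun q => P.obj (a q.1 q.2)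
    let β' : (Σ j, Fin (i j)) → Type u := fun q => Fin (a q.1 q.2) → V
    obtain ⟨ξ, rfl⟩ : ∃ ξ' : ∀ j l, P.obj (a j l),
        ξ = fun p => ξ' ((flat i).symm p).1 ((flat i).symm p).2 :=
      ⟨fun j l => (Equiv.piCongrLeft β (flat i).symm) ξ ⟨j, l⟩, by
        funext p; exact (Equiv.piCongrLeft_apply_apply β (flat i).symm ξ p).symm⟩
    obtain ⟨v, rfl⟩ : ∃ v' : ∀ j l, Fin (a j l) → V,
        v = fun p => v' ((flat i).symm p).1 ((flat i).symm p).2 :=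
      ⟨fun j l => (Equiv.piCongrLeft β' (flat i).symm) v ⟨j, l⟩, by
        funext p; exact (Equiv.piCongrLeft_apply_apply β' (flat i).symm v p).symm⟩
    have h1 : ∀ j l, P.cls (ξ ((flat i).symm (flat i ⟨j, l⟩)).1 ((flat i).symm (flat i ⟨j, l⟩)).2)
        (v ((flat i).symm (flat i ⟨j, l⟩)).1 ((flat i).symm (flat i ⟨j, l⟩)).2) =
        P.cls (ξ j l) (v j l) := by
      intro j l
      change (fun q : (Σ j, Fin (i j)) => P.cls (ξ q.1 q.2) (v q.1 q.2))
        ((flat i).symm (flat i ⟨j, l⟩)) = _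
      rw [Equiv.symm_apply_apply]
    have h2 : (fun p => unflat (fun p => v ((flat i).symm p).1 ((flat i).symm p).2)
        ((blockAssoc a).symm p)) = unflat fun j => unflat (v j) := by
      funext p
      obtain ⟨p, rfl⟩ := (blockAssoc a).surjective p
      obtain ⟨⟨p, t⟩, rfl⟩ := (flat _).surjective p
      rw [Equiv.symm_apply_apply, blockAssoc_flat, unflat_flat, unflat_flat, unflat_flat]
    rw [compBlocks_apply, P.freeOp_cls, P.comp_assoc, P.cls_act, h2]
    simp only [h1]
    rw [← P.freeOp_cls]
    congr 1
    funext j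
    rw [P.freeOp_cls]

/-- On the generators `(id; v_j)` of `P(V)`, the operation `μ` takes the value `(μ; v₁, …, v_n)`. -/
theorem Operad.freeOp_gen {n : ℕ} (μ : P.obj n) (v : Fin n → V) :
    P.freeOp V μ (fun j => P.cls P.one fun _ => v j) = P.cls μ v := by
  rw [P.freeOp_cls, P.comp_one, P.cls_act]
  congr 1
  funext p
  obtain ⟨p, rfl⟩ := (blockOnes n).surjective p
  obtain ⟨⟨j, l⟩, rfl⟩ := (flat _).surjective p
  rw [Equiv.symm_apply_apply, blockOnes_flat, unflat_flat]

/-- The free `P`-algebra `P(V)`, with `μ((ν₁; v₁), …, (ν_k; v_k)) = (μ ∘ (ν₁, …, ν_k); v₁, …, v_k)`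
where the `v_j` are finite sequences of vectors. -/
noncomputable def Operad.freeAlgebra : OperadAlgebra P (P.Schur V) where
  op {n} :=
    { toFun := P.freeOp V
      map_add' := P.freeOp_add V
      map_smul' := P.freeOp_smul V }
  op_act {m n} e μ x := by
    have := congrArg (fun F => F x) (P.freeOp_act V e μ)
    simpa using this
  op_one x := P.freeOp_one V x
  op_comp {k i} μ ν x := by
    have := congrArg (fun F => F x) (P.freeOp_comp V μ ν)
    simpa using this

end Free

/-! ### Generalized bialgebras -/

/-- Formal composites of multivalued operations with `m` inputs and `n` outputs, generated by the
operations of `A`, the cooperations of `C` and the permutations of inputs and outputs under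
composition, tensor product and linear combination. -/
inductive PropExpr (C A : Operad K) : ℕ → ℕ → Type u
  | perm {m n : ℕ} (e : Fin m ≃ Fin n) : PropExpr C A m n
  | op {n : ℕ} (μ : A.obj n) : PropExpr C A n 1
  | coop {n : ℕ} (δ : C.obj n) : PropExpr C A 1 n
  | comp {l m n : ℕ} (f : PropExpr C A m n) (g : PropExpr C A l m) : PropExpr C A l n
  | tensor {k : ℕ} {m n : Fin k → ℕ} (f : ∀ j, PropExpr C A (m j) (n j)) :
      PropExpr C A (∑ j, m j) (∑ j, n j)
  | zero {m n : ℕ} : PropExpr C A m n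
  | add {m n : ℕ} (f g : PropExpr C A m n) : PropExpr C A m n
  | smul {m n : ℕ} (c : K) (f : PropExpr C A m n) : PropExpr C A m n

/-- The operation `μ` as a linear map `H^{⊗ n} → H`. -/
noncomputable def OperadAlgebra.opTensor {P : Operad K} {H : Type u} [AddCommGroup H] [Module K H]
    (a : OperadAlgebra P H) {n : ℕ} (μ : P.obj n) : (⨂[K] _j : Fin n, H) →ₗ[K] H :=
  PiTensorProduct.lift (a.op μ)

/-- The map `H^{⊗ m} → H^{⊗ n}` defined by a formal composite on a space `H` that is both an
`A`-algebra and a `C`-coalgebra. -/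
noncomputable def PropExpr.eval {C A : Operad K} {H : Type u} [AddCommGroup H] [Module K H]
    (a : OperadAlgebra A H) (c : OperadCoalgebra C H) : ∀ {m n : ℕ}, PropExpr C A m n →
      ((⨂[K] _j : Fin m, H) →ₗ[K] ⨂[K] _j : Fin n, H)
  | _, _, .perm e => (PiTensorProduct.reindex K (fun _ => H) e).toLinearMap
  | _, _, .op μ =>
      (PiTensorProduct.subsingletonEquiv (R := K) (s := fun _ => H) (0 : Fin 1)).symm.toLinearMap ∘ₗ
        a.opTensor μ
  | _, _, .coop δ =>
      c.coop δ ∘ₗ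
        (PiTensorProduct.subsingletonEquiv (R := K) (s := fun _ => H) (0 : Fin 1)).toLinearMap
  | _, _, .comp f g => f.eval a c ∘ₗ g.eval a c
  | _, _, .tensor (m := m) (n := n) f =>
      join K H n ∘ₗ PiTensorProduct.map (fun j => (f j).eval a c) ∘ₗ split K H m
  | _, _, .zero => 0
  | _, _, .add f g => f.eval a c + g.eval a c
  | _, _, .smul r f => r • f.eval a c

/-- A type of generalized bialgebras: an operad `C` for the coalgebra structure, an operad `A`
for the algebra structure, and a set of compatibility relations, each of them an equality between
two formal composites of operations and cooperations. -/
structure BialgebraType (K : Type u) [Field K] where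
  C : Operad K
  A : Operad K
  rel : ∀ {m n : ℕ}, PropExpr C A m n → PropExpr C A m n → Prop

/-- A generalized bialgebra of type `T`. -/
structure BialgebraType.Bialgebra (T : BialgebraType K) (H : Type u) [AddCommGroup H]
    [Module K H] where
  alg : OperadAlgebra T.A H
  coalg : OperadCoalgebra T.C H
  compat : ∀ {m n : ℕ} (f g : PropExpr T.C T.A m n), T.rel f g →
    f.eval alg coalg = g.eval alg coalg

/-- One summand `(μ₁ ⊗ ⋯ ⊗ μ_m) ∘ ω ∘ (δ₁ ⊗ ⋯ ⊗ δ_n)` of the right-hand side of a distributive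
compatibility relation: first cooperations, then `ω ∈ K[S_r]` (given by its coefficients),
then operations. -/
structure DistributiveTerm (C A : Operad K) (n m : ℕ) where
  k : Fin m → ℕ
  l : Fin n → ℕ
  r : ℕ
  sum_k : ∑ j, k j = r
  sum_l : ∑ i, l i = r
  μ : ∀ j, A.obj (k j)
  δ : ∀ i, C.obj (l i)
  ω : Equiv.Perm (Fin r) → K

/-- The map `H^{⊗ n} → H^{⊗ m}` defined by such a summand. -/
noncomputable def DistributiveTerm.eval {C A : Operad K} {n m : ℕ} (t : DistributiveTerm C A n m)
    {H : Type u} [AddCommGroup H] [Module K H]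
    (a : OperadAlgebra A H) (c : OperadCoalgebra C H) :
    (⨂[K] _i : Fin n, H) →ₗ[K] ⨂[K] _j : Fin m, H :=
  (PiTensorProduct.map (fun j => a.opTensor (t.μ j)) ∘ₗ split K H t.k ∘ₗ
      (PiTensorProduct.reindex K (fun _ => H) (finCongr t.sum_k.symm)).toLinearMap) ∘ₗ
    (∑ σ, t.ω σ • (PiTensorProduct.reindex K (fun _ => H) σ).toLinearMap) ∘ₗ
    ((PiTensorProduct.reindex K (fun _ => H) (finCongr t.sum_l)).toLinearMap ∘ₗ join K H t.l ∘ₗ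
      PiTensorProduct.map (fun i => c.coop (t.δ i)))

/-- Hypothesis (H0): any pair `(δ, μ)` satisfies a distributive compatibility relation
`δ ∘ μ = ∑ (μ₁ ⊗ ⋯ ⊗ μ_m) ∘ ω ∘ (δ₁ ⊗ ⋯ ⊗ δ_n)` in the bialgebras of type `T`. -/
def BialgebraType.H0 (T : BialgebraType K) : Prop :=
  ∀ (n m : ℕ) (μ : T.A.obj n) (δ : T.C.obj m), ∃ Φ : List (DistributiveTerm T.C T.A n m),
    ∀ (H : Type u) [AddCommGroup H] [Module K H] (b : T.Bialgebra H),
      b.coalg.coop δ ∘ₗ b.alg.opTensor μ = (Φ.map fun t => t.eval b.alg b.coalg).sum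

/-- Hypothesis (H1): the free `A`-algebras `A(V)` are equipped with structures of bialgebras of
type `T` (extending their `A`-algebra structure), functorially in the vector space `V`. -/
structure BialgebraType.H1 (T : BialgebraType K) where
  bialgebra : ∀ (V : Type u) [AddCommGroup V] [Module K V], T.Bialgebra (T.A.Schur V)
  alg_eq : ∀ (V : Type u) [AddCommGroup V] [Module K V],
    (bialgebra V).alg = T.A.freeAlgebra V
  map_isHom : ∀ (V W : Type u) [AddCommGroup V] [Module K V] [AddCommGroup W] [Module K W]
    (f : V →ₗ[K] W), (bialgebra V).coalg.IsHom (bialgebra W).coalg (T.A.map f)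

/-- The primitive operations: the `μ ∈ A(n)` such that the element `(μ; x₁, …, x_n)` of
`A(K x₁ ⊕ ⋯ ⊕ K x_n)` is primitive. -/
noncomputable def BialgebraType.H1.primOps {T : BialgebraType K} (h : T.H1) (n : ℕ) :
    Submodule K (T.A.obj n) where
  carrier := {μ | T.A.cls μ (fun j : Fin n => (Pi.single j 1 : Fin n → K)) ∈
    (h.bialgebra (Fin n → K)).coalg.prim}
  zero_mem' := by
    simp only [Set.mem_ofPred_eq, ← SModule.mkMultilinear_apply, map_zero,
      zero_apply, zero_mem]
  add_mem' hx hy := by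
    simp only [Set.mem_ofPred_eq, ← SModule.mkMultilinear_apply, map_add, add_apply] at hx hy ⊢
    exact add_mem hx hy
  smul_mem' c x hx := by
    simp only [Set.mem_ofPred_eq, ← SModule.mkMultilinear_apply, map_smul, smul_apply] at hx ⊢
    exact Submodule.smul_mem _ c hx

end GenBialg

/-!
The heart of the matter is that a primitive operation `μ` sends primitive elements
`x₁, …, x_n` of any bialgebra `H` to a primitive element; the suboperad axioms and the algebra
structure on `Prim H` are then immediate.

Let `f : A(Kⁿ) → H` be the morphism of `A`-algebras with `f(e_i) = x_i`. It need not commute with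
cooperations. However, if the `e_i` are primitive in `A(Kⁿ)`, then `δ(f(e_i)) = f^{⊗ m}(δ(e_i))`
for every `δ ∈ C(m)`: both sides vanish if `m ≥ 2`, and `C(0) = 0`, `C(1) = K id`. As the
right-hand side of a distributive relation for `δ ∘ μ` applies the cooperations first, and then
only permutations and operations of `A`, which `f` respects, it follows that
`δ(μ(x₁, …, x_n)) = f^{⊗ m}(δ(μ(e₁, …, e_n)))`, which is zero for `m ≥ 2` because `μ` is a
primitive operation (`OperadAlgebra.IsHom.coop_op`, `BialgebraType.H1.op_mem_prim`).

That the generators of a free algebra are primitive is where functoriality in `V` enters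
(`BialgebraType.H1.cls_one_mem_prim`). By naturality with respect to `2 : V → V`, the tensor
`δ(v) ∈ A(V)^{⊗ m}` is an eigenvector of `A(2)^{⊗ m}` for the eigenvalue `2`. Since `A(0) = 0`,
the space `A(V)^{⊗ m}` is spanned by eigenvectors for the eigenvalues `2^d` with `d ≥ m`, so
`δ(v) = 0` as soon as `m ≥ 2`.
-/

namespace GenBialg

open scoped TensorProduct DirectSum

/-! ### Naturality of the maps that make up a distributive relation -/

section Naturality

variable {K : Type u} [Field K] {M N : Type u} [AddCommGroup M] [Module K M]
  [AddCommGroup N] [Module K N]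

theorem split_map (f : M →ₗ[K] N) {k : ℕ} (i : Fin k → ℕ) (t : ⨂[K] _p : Fin (∑ j, i j), M) :
    split K N i (PiTensorProduct.map (fun _ => f) t) =
      PiTensorProduct.map (fun _ => PiTensorProduct.map fun _ => f) (split K M i t) := by
  have : split K N i ∘ₗ PiTensorProduct.map (fun _ => f) =
      PiTensorProduct.map (fun _ => PiTensorProduct.map fun _ => f) ∘ₗ split K M i :=
    PiTensorProduct.ext (MultilinearMap.ext fun x => by
      simp [PiTensorProduct.map_tprod, split_tprod])
  exact LinearMap.congr_fun this t

theorem join_map (f : M →ₗ[K] N) {k : ℕ} (i : Fin k → ℕ) (t : ⨂[K] j, ⨂[K] _l : Fin (i j), M) :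
    join K N i (PiTensorProduct.map (fun _ => PiTensorProduct.map fun _ => f) t) =
      PiTensorProduct.map (fun _ => f) (join K M i t) := by
  have : join K N i ∘ₗ PiTensorProduct.map (fun _ => PiTensorProduct.map fun _ => f) =
      PiTensorProduct.map (fun _ => f) ∘ₗ join K M i :=
    PiTensorProduct.ext (MultilinearMap.ext_of_span_eq_top
      (g := fun {j} (x : Fin (i j) → M) => PiTensorProduct.tprod K x)
      (fun _ => span_range_tprod _) fun x => by
        simp only [LinearMap.compMultilinearMap_apply, LinearMap.comp_apply,
          PiTensorProduct.map_tprod, join_tprod]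
        rfl)
  exact LinearMap.congr_fun this t

theorem OperadAlgebra.IsHom.opTensor_map {P : Operad K} {a : OperadAlgebra P M}
    {b : OperadAlgebra P N} {f : M →ₗ[K] N} (hf : a.IsHom b f) {n : ℕ} (μ : P.obj n) :
    b.opTensor μ ∘ₗ PiTensorProduct.map (fun _ => f) = f ∘ₗ a.opTensor μ :=
  PiTensorProduct.ext (MultilinearMap.ext fun x => by
    simp [OperadAlgebra.opTensor, PiTensorProduct.map_tprod, hf n μ x])

variable {C A : Operad K}

/-- A morphism of algebras that commutes with all cooperations on the given elements `x i`
commutes with the summands of distributive relations on `x₁ ⊗ ⋯ ⊗ x_n`, as these apply all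
cooperations first. -/
theorem DistributiveTerm.eval_tprod_map {n m : ℕ} (t : DistributiveTerm C A n m)
    {a : OperadAlgebra A M} {c : OperadCoalgebra C M} {a' : OperadAlgebra A N}
    {c' : OperadCoalgebra C N} {f : M →ₗ[K] N} (hf : a.IsHom a' f) (x : Fin n → M)
    (hx : ∀ (i : Fin n) (l : ℕ) (δ : C.obj l),
      c'.coop δ (f (x i)) = PiTensorProduct.map (fun _ => f) (c.coop δ (x i))) :
    t.eval a' c' (PiTensorProduct.tprod K fun i => f (x i)) =
      PiTensorProduct.map (fun _ => f) (t.eval a c (PiTensorProduct.tprod K x)) := by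
  have hre : ∀ {p q : ℕ} (e : Fin p ≃ Fin q) (s : ⨂[K] _j : Fin p, M),
      PiTensorProduct.reindex K (fun _ => N) e (PiTensorProduct.map (fun _ => f) s) =
        PiTensorProduct.map (fun _ => f) (PiTensorProduct.reindex K (fun _ => M) e s) :=
    fun e s => (PiTensorProduct.map_reindex (fun _ => f) e s).symm
  have hco : PiTensorProduct.map (fun i => c'.coop (t.δ i))
      (PiTensorProduct.tprod K fun i => f (x i)) =
      PiTensorProduct.map (fun _ => PiTensorProduct.map fun _ => f)
        (PiTensorProduct.map (fun i => c.coop (t.δ i)) (PiTensorProduct.tprod K x)) := by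
    simp only [PiTensorProduct.map_tprod, hx]
  have hop : ∀ s, PiTensorProduct.map (fun j => a'.opTensor (t.μ j))
      (PiTensorProduct.map (fun _ => PiTensorProduct.map fun _ => f) s) =
      PiTensorProduct.map (fun _ => f) (PiTensorProduct.map (fun j => a.opTensor (t.μ j)) s) := by
    intro s
    rw [← LinearMap.comp_apply, ← LinearMap.comp_apply, ← PiTensorProduct.map_comp,
      ← PiTensorProduct.map_comp]
    simp only [hf.opTensor_map]
  simp only [DistributiveTerm.eval, LinearMap.comp_apply, LinearEquiv.coe_coe,
    LinearMap.sum_apply, LinearMap.smul_apply]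
  rw [hco, join_map, hre]
  simp only [hre, ← map_smul, ← map_sum]
  rw [split_map, hop]

end Naturality

/-! ### Morphisms of algebras and primitive elements -/

section Primitive

variable {K : Type u} [Field K] {M N : Type u} [AddCommGroup M] [Module K M]
  [AddCommGroup N] [Module K N]

/-- Any linear map commutes with all cooperations on a primitive element with primitive image. -/
theorem OperadCoalgebra.coop_map_of_mem_prim {C : Operad K} (hC : C.IsSimplyConnected)
    {c : OperadCoalgebra C M} {c' : OperadCoalgebra C N} (f : M →ₗ[K] N) {x : M}
    (hx : x ∈ c.prim) (hfx : f x ∈ c'.prim) {n : ℕ} (δ : C.obj n) :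
    c'.coop δ (f x) = PiTensorProduct.map (fun _ => f) (c.coop δ x) := by
  match n, δ with
  | 0, δ => simp [hC.zero δ]
  | 1, δ =>
    obtain ⟨r, rfl⟩ := hC.exists_smul_one δ
    simp [c.coop_one, c'.coop_one, PiTensorProduct.map_tprod]
  | n + 2, δ => rw [hx _ (by lia) δ, hfx _ (by lia) δ, map_zero]

/-- Under (H0), a morphism of algebras commutes with the composites of an operation and a
cooperation on primitive elements with primitive images, even though it need not be a morphism of
coalgebras. -/
theorem OperadAlgebra.IsHom.coop_op {T : BialgebraType K} (hC : T.C.IsSimplyConnected)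
    (h0 : T.H0) {b : T.Bialgebra M} {b' : T.Bialgebra N} {f : M →ₗ[K] N}
    (hf : b.alg.IsHom b'.alg f) {n m : ℕ} (μ : T.A.obj n) (δ : T.C.obj m) (x : Fin n → M)
    (hx : ∀ i, x i ∈ b.coalg.prim) (hfx : ∀ i, f (x i) ∈ b'.coalg.prim) :
    b'.coalg.coop δ (b'.alg.op μ fun i => f (x i)) =
      PiTensorProduct.map (fun _ => f) (b.coalg.coop δ (b.alg.op μ x)) := by
  obtain ⟨Φ, hΦ⟩ := h0 n m μ δ
  have h1 := LinearMap.congr_fun (hΦ M b) (PiTensorProduct.tprod K x)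
  have h2 := LinearMap.congr_fun (hΦ N b') (PiTensorProduct.tprod K fun i => f (x i))
  simp only [LinearMap.comp_apply, OperadAlgebra.opTensor, PiTensorProduct.lift.tprod] at h1 h2
  rw [h1, h2]
  clear h1 h2 hΦ
  induction Φ with
  | nil => simp
  | cons t Φ ih =>
    rw [List.map_cons, List.map_cons, List.sum_cons, List.sum_cons, LinearMap.add_apply,
      LinearMap.add_apply, map_add, ih, t.eval_tprod_map hf x fun i l δ' =>
        OperadCoalgebra.coop_map_of_mem_prim hC f (hx i) (hfx i) δ']

end Primitive

/-! ### Free algebras -/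

section Free

variable {K : Type u} [Field K]

/-- The universal property of free algebras (existence part). -/
theorem OperadAlgebra.exists_isHom_freeAlgebra {P : Operad K} {V M : Type u} [AddCommGroup V]
    [Module K V] [AddCommGroup M] [Module K M] (a : OperadAlgebra P M) (g : V →ₗ[K] M) :
    ∃ f : P.Schur V →ₗ[K] M, (P.freeAlgebra V).IsHom a f ∧
      ∀ v, f (P.cls P.one fun _ => v) = g v := by
  have hex : ∀ n, ∃ ψ : P.SchurSummand V n →ₗ[K] M, ∀ (μ : P.obj n) (v : Fin n → V),
      ψ (P.mkSummand μ v) = a.op μ fun j => g (v j) := fun n =>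
    SModule.exists_linear
      (MultilinearMap.compLinearMapₗ (fun _ : Fin n => g) ∘ₗ (a.op (n := n)))
      fun σ μ v => a.op_act σ μ _
  choose ψ hψ using hex
  let f : P.Schur V →ₗ[K] M := DirectSum.toModule K ℕ M ψ
  have hf : ∀ {n : ℕ} (μ : P.obj n) (v : Fin n → V),
      f (P.cls μ v) = a.op μ fun j => g (v j) := fun {n} μ v =>
    (DirectSum.toModule_lof K n (P.mkSummand μ v)).trans (hψ n μ v)
  refine ⟨f, fun n μ x => ?_, fun v => by rw [hf, a.op_one]⟩
  have : f.compMultilinearMap (P.freeOp V μ) = (a.op μ).compLinearMap fun _ => f :=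
    P.multilinear_ext V fun i ν v => by
      rw [LinearMap.compMultilinearMap_apply, P.freeOp_cls, MultilinearMap.compLinearMap_apply,
        hf, a.op_comp]
      simp only [hf, unflat_flat]
  exact congrArg (fun F => F x) this

theorem SModule.map_smul_id_cls (S : SModule K) {V : Type u} [AddCommGroup V] [Module K V]
    (r : K) {n : ℕ} (μ : S.obj n) (v : Fin n → V) :
    S.map (r • LinearMap.id) (S.cls μ v) = r ^ n • S.cls μ v := by
  rw [S.map_cls]
  have := (S.mkMultilinear V n μ).map_smul_univ (fun _ => r) v
  simpa using this

/-- `A(2)^{⊗ m}` has no eigenvectors for the eigenvalue `2` if `m ≥ 2`: its eigenvectors for the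
eigenvalues `2^d`, `d ≥ m`, span the whole space, and `2^d ≠ 2` in characteristic zero. -/
theorem Operad.eq_zero_of_map_two [CharZero K] {A : Operad K} (hA : A.IsSimplyConnected)
    {V : Type u} [AddCommGroup V] [Module K V] {m : ℕ} (hm : 2 ≤ m)
    {z : ⨂[K] _j : Fin m, A.Schur V}
    (hz : PiTensorProduct.map (fun _ => A.map ((2 : K) • LinearMap.id)) z = (2 : K) • z) :
    z = 0 := by
  let D : Module.End K (⨂[K] _j : Fin m, A.Schur V) :=
    PiTensorProduct.map fun _ => A.map ((2 : K) • LinearMap.id)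
  have hz1 : z ∈ D.eigenspace 2 := Module.End.mem_eigenspace_iff.2 hz
  have hspan : ∀ x : Fin m → A.Schur V, PiTensorProduct.tprod K x ∈
      ⨆ r ≠ (2 : K), D.eigenspace r := by
    let q := (⨆ r ≠ (2 : K), D.eigenspace r).mkQ
    have h0 : q.compMultilinearMap (PiTensorProduct.tprod K) = 0 :=
      A.multilinear_ext V fun i ν v => by
        rw [LinearMap.compMultilinearMap_apply, zero_apply, Submodule.mkQ_apply,
          Submodule.Quotient.mk_eq_zero]
        by_cases hi : ∃ j, i j = 0
        -- A factor of arity zero vanishes, so only summands of weight at least `m` remain.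
        · obtain ⟨j, hj⟩ := hi
          have hν : ∀ {n : ℕ} (μ : A.obj n) (w : Fin n → V), n = 0 → A.cls μ w = 0 := by
            rintro _ μ w rfl
            rw [hA.zero μ, ← SModule.mkMultilinear_apply, map_zero, zero_apply]
          rw [MultilinearMap.map_coord_zero _ j (hν _ _ hj)]
          exact zero_mem _
        · have hd : m ≤ ∑ j, i j := by
            simpa using Finset.sum_le_sum fun j (_ : j ∈ Finset.univ) =>
              Nat.one_le_iff_ne_zero.2 fun h => hi ⟨j, h⟩
          have hne : (2 : K) ^ (∑ j, i j) ≠ 2 := by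
            intro h
            have h' : 2 ^ (∑ j, i j) = 2 ^ 1 := by exact_mod_cast h
            have := Nat.pow_right_injective le_rfl h'
            lia
          refine Submodule.mem_iSup_of_mem _ (Submodule.mem_iSup_of_mem hne ?_)
          rw [Module.End.mem_eigenspace_iff, PiTensorProduct.map_tprod]
          simp only [SModule.map_smul_id_cls]
          rw [MultilinearMap.map_smul_univ, Finset.prod_pow_eq_pow_sum]
    intro x
    have := congrArg (fun F => F x) h0
    simpa [q] using this
  have hz2 : z ∈ ⨆ r ≠ (2 : K), D.eigenspace r := by
    have hle : Submodule.span K (Set.range (PiTensorProduct.tprod K)) ≤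
        ⨆ r ≠ (2 : K), D.eigenspace r :=
      Submodule.span_le.2 (Set.range_subset_iff.2 hspan)
    rw [PiTensorProduct.span_tprod_eq_top] at hle
    exact hle trivial
  exact Submodule.disjoint_def.1 (D.eigenspaces_iSupIndep 2) z hz1 hz2

/-- The generators of the free algebra `A(V)` are primitive. -/
theorem BialgebraType.H1.cls_one_mem_prim [CharZero K] {T : BialgebraType K} (h1 : T.H1)
    (hA : T.A.IsSimplyConnected) {V : Type u} [AddCommGroup V] [Module K V] (v : V) :
    T.A.cls T.A.one (fun _ => v) ∈ (h1.bialgebra V).coalg.prim := by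
  intro m hm δ
  refine Operad.eq_zero_of_map_two hA hm ?_
  rw [← h1.map_isHom V V ((2 : K) • LinearMap.id) m δ, SModule.map_smul_id_cls, pow_one, map_smul]

end Free

/-! ### Primitive operations -/

section PrimitiveOperations

variable {K : Type u} [Field K] {T : BialgebraType K}

theorem BialgebraType.H1.mem_primOps (h1 : T.H1) {n : ℕ} {μ : T.A.obj n} :
    μ ∈ h1.primOps n ↔ T.A.cls μ (fun j : Fin n => (Pi.single j 1 : Fin n → K)) ∈
      (h1.bialgebra (Fin n → K)).coalg.prim := Iff.rfl

variable [CharZero K]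

/-- Primitive operations preserve primitive elements. -/
theorem BialgebraType.H1.op_mem_prim (h1 : T.H1) (hA : T.A.IsSimplyConnected)
    (hC : T.C.IsSimplyConnected) (h0 : T.H0) {H : Type u} [AddCommGroup H] [Module K H]
    (b : T.Bialgebra H) {n : ℕ} {μ : T.A.obj n} (hμ : μ ∈ h1.primOps n) {x : Fin n → H}
    (hx : ∀ j, x j ∈ b.coalg.prim) : b.alg.op μ x ∈ b.coalg.prim := by
  obtain ⟨f, hf, hfg⟩ :=
    b.alg.exists_isHom_freeAlgebra (Fintype.linearCombination K x)
  rw [← h1.alg_eq] at hf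
  let e : Fin n → T.A.Schur (Fin n → K) := fun j => T.A.cls T.A.one fun _ => Pi.single j 1
  have hfe : ∀ j, f (e j) = x j := fun j => by simp [e, hfg]
  have hμe : (h1.bialgebra (Fin n → K)).alg.op μ e =
      T.A.cls μ fun j => (Pi.single j 1 : Fin n → K) := by
    rw [h1.alg_eq]
    exact T.A.freeOp_gen _ μ _
  intro m hm δ
  have h := hf.coop_op hC h0 μ δ e (fun j => h1.cls_one_mem_prim hA _)
    (fun j => by rw [hfe]; exact hx j)
  rw [hμe, hμ m hm δ, map_zero] at h
  simpa only [hfe] using h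

/-- The values of primitive operations on arbitrary generators of a free algebra are
primitive. -/
theorem BialgebraType.H1.cls_mem_prim (h1 : T.H1) (hA : T.A.IsSimplyConnected)
    (hC : T.C.IsSimplyConnected) (h0 : T.H0) {V : Type u} [AddCommGroup V] [Module K V]
    {n : ℕ} {μ : T.A.obj n} (hμ : μ ∈ h1.primOps n) (v : Fin n → V) :
    T.A.cls μ v ∈ (h1.bialgebra V).coalg.prim := by
  have h := h1.op_mem_prim hA hC h0 (h1.bialgebra V) hμ
    fun j => h1.cls_one_mem_prim hA (v j)
  rw [h1.alg_eq] at h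
  rwa [← T.A.freeOp_gen]

/-- The suboperad of primitive operations. -/
noncomputable def BialgebraType.H1.primSuboperad (h1 : T.H1) (hA : T.A.IsSimplyConnected)
    (hC : T.C.IsSimplyConnected) (h0 : T.H0) : Suboperad T.A where
  carrier := h1.primOps
  act_mem {m n} e μ hμ := by
    rw [h1.mem_primOps, T.A.cls_act]
    exact h1.cls_mem_prim hA hC h0 hμ _
  one_mem := by
    have h := h1.cls_one_mem_prim hA (Pi.single 0 1 : Fin 1 → K)
    rw [h1.mem_primOps]
    convert h using 3 with j
    rw [Subsingleton.elim j 0]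
  comp_mem {k i} μ ν hμ hν := by
    let v : ∀ j, Fin (i j) → Fin (∑ j, i j) → K := fun j l => Pi.single (flat i ⟨j, l⟩) 1
    have hv : unflat v = fun p => Pi.single p 1 := by
      funext p
      obtain ⟨⟨j, l⟩, rfl⟩ := (flat i).surjective p
      rw [unflat_flat]
    have h := h1.op_mem_prim hA hC h0 (h1.bialgebra (Fin (∑ j, i j) → K)) hμ
      fun j => h1.cls_mem_prim hA hC h0 (hν j) (v j)
    rw [h1.alg_eq] at h
    rw [h1.mem_primOps, ← hv, ← T.A.freeOp_cls]
    exact h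

end PrimitiveOperations

/-- A submodule that is stable under the operations of a suboperad is an algebra over it. -/
def OperadAlgebra.restrictSubmodule {K : Type u} [Field K] {P : Operad K} {M : Type u}
    [AddCommGroup M] [Module K M] (a : OperadAlgebra P M) (Q : Suboperad P) (L : Submodule K M)
    (hL : ∀ {n : ℕ} {μ : P.obj n}, μ ∈ Q.carrier n → ∀ {x : Fin n → M}, (∀ j, x j ∈ L) →
      a.op μ x ∈ L) : OperadAlgebra Q.toOperad L where
  op :=
    { toFun := fun μ =>
        ((a.op μ.1).compLinearMap fun _ => L.subtype).codRestrict L fun x =>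
          hL μ.2 fun j => (x j).2
      map_add' := fun μ μ' => MultilinearMap.ext fun x => Subtype.ext <|
        congrArg (fun F => F fun j => (x j).1) (a.op.map_add μ.1 μ'.1)
      map_smul' := fun c μ => MultilinearMap.ext fun x => Subtype.ext <|
        congrArg (fun F => F fun j => (x j).1) (a.op.map_smul c μ.1) }
  op_act e μ x := Subtype.ext (a.op_act e μ.1 fun j => (x j).1)
  op_one x := Subtype.ext (a.op_one fun j => (x j).1)
  op_comp μ ν x := Subtype.ext (a.op_comp μ.1 (fun j => (ν j).1) fun p => (x p).1)

end GenBialg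

/-- The primitive operations form a suboperad `P` of `A`; the primitive part of every bialgebra `H`
is a `P`-algebra and its inclusion into `H` is a morphism of `P`-algebras. -/
theorem theorem2p2 {K : Type u} [Field K] [CharZero K] (T : GenBialg.BialgebraType K)
    (hA : T.A.IsSimplyConnected) (hC : T.C.IsSimplyConnected) (h0 : T.H0) (h1 : T.H1) :
    ∃ P : GenBialg.Suboperad T.A, (∀ n : ℕ, P.carrier n = h1.primOps n) ∧
      ∀ (H : Type u) [AddCommGroup H] [Module K H] (b : T.Bialgebra H),
        ∃ a : GenBialg.OperadAlgebra P.toOperad b.coalg.prim,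
          a.IsHom (b.alg.restrict P) b.coalg.prim.subtype :=
  ⟨h1.primSuboperad hA hC h0, fun _ => rfl, fun _ _ _ b =>
    ⟨b.alg.restrictSubmodule _ _ fun hμ _ hx => h1.op_mem_prim hA hC h0 b hμ hx,
      fun _ _ _ => rfl⟩⟩
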